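/- Let $G$ be a simple connected graph on $n\ge 3$ vertices, with vertex degrees $d_1(G)\ge d_2(G)\ge\dots\ge d_n(G)$. Let $A$ be the adjacency matrix of $G$ and $D$ the diagonal matrix of its vertex degrees, and let $q_1(G)\ge q_2(G)\ge\dots\ge q_n(G)$ be the eigenvalues, listed with multiplicity, of the signless Laplacian matrix $Q(G)=A+D$. Then $$q_1(G)+q_2(G)\ \ge\ d_1(G)+d_2(G)+1.$$ Equality holds if and only if $G$ is (up to isomorphism) the complete graph $K_3$ or the star $S_n$ on $n$ vertices, that is, the graph in which one vertex is adjacent to all the others and there are no other edges. -/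

import Mathlib

namespace SimpleGraph

/-- The signless Laplacian matrix `Q = D + A` of a graph, over `ℝ`. -/
def signlessLapMatrix {V : Type*} [Fintype V] [DecidableEq V] (G : SimpleGraph V)
    [DecidableRel G.Adj] : Matrix V V ℝ :=
  G.degMatrix ℝ + G.adjMatrix ℝ

theorem isHermitian_signlessLapMatrix {V : Type*} [Fintype V] [DecidableEq V]
    (G : SimpleGraph V) [DecidableRel G.Adj] : G.signlessLapMatrix.IsHermitian :=
  (G.isHermitian_degMatrix ℝ).add (G.isHermitian_adjMatrix ℝ)

/-- The signless Laplacian eigenvalues, with multiplicity, in non-increasing order.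
The index starts at `0`: index `0` is the largest eigenvalue. -/
noncomputable def signlessLapEigenvalue {V : Type*} [Fintype V] [DecidableEq V]
    (G : SimpleGraph V) [DecidableRel G.Adj] : Fin (Fintype.card V) → ℝ :=
  G.isHermitian_signlessLapMatrix.eigenvalues₀

/-- The list of all vertex degrees, with multiplicity, in non-increasing order. -/
def degreeList {V : Type*} [Fintype V] (G : SimpleGraph V) [DecidableRel G.Adj] : List ℕ :=
  ((Finset.univ : Finset V).val.map fun v => G.degree v).sort (· ≥ ·)

theorem length_degreeList {V : Type*} [Fintype V] (G : SimpleGraph V) [DecidableRel G.Adj] :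
    G.degreeList.length = Fintype.card V := by
  simp [degreeList]

/-- The degree sequence in non-increasing order. The index starts at `0`: index `0` is the
largest degree. -/
def degreeSequence {V : Type*} [Fintype V] (G : SimpleGraph V) [DecidableRel G.Adj]
    (i : Fin (Fintype.card V)) : ℕ :=
  G.degreeList.get (i.cast G.length_degreeList.symm)

end SimpleGraph

/-!
Let `M` be the vertex-edge incidence matrix, so that `Q = M Mᵀ`. The matrices `M Mᵀ` and `Mᵀ M`
have the same nonzero eigenvalues, so Ky Fan's principle can be used on the edge side: for nonzero
orthogonal `f`, `g` in the space of functions on edges,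
`|M f|² / |f|² + |M g|² / |g|² ≤ q₁ + q₂`
(`Matrix.IsHermitian.mulVec_dotProduct_div_add_le`). Everything rests on a choice of `f` and `g`
made of edges at two vertices `u`, `v` of the largest degrees.

* If `u` and `v` are not adjacent, the indicators of the edges at `u` and of the edges at `v` are
  orthogonal and give `d(u) + d(v) + 2` (`SimpleGraph.degree_add_degree_add_two_le`).
* If they are adjacent and both have another neighbour, put `a = d(u) - 1`, `b = d(v) - 1`, and let
  `c` be the number of their common neighbours. A pair of vectors in the span of `e = uv` and the
  indicators `f_u`, `f_v` of the other edges at `u` and at `v` gives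
  `d(u) + d(v) + 1 + 2(ab - c) / ((a + b)(a + b + 1))`
  (`SimpleGraph.degree_add_degree_add_one_add_le`). Here `c ≤ min(a, b) ≤ ab`, and `c = ab` with
  `a ≥ b` forces `a = b = c = 1`; then all degrees are at most `2`, and a connected graph of this
  kind that contains a triangle is `K₃`.
* If `d(v) = 1`, every vertex other than `u` has degree at most `1`, so the graph is a star, and
  the second vector is the difference of two edges at `u` (`SimpleGraph.degree_add_two_le`).

That equality does hold for `K₃` and for stars follows from the trace: for `K₃` all eigenvalues are
at least `1` since `Q = I + J`, and for a star on `n` vertices they lie in `{0, 1, n}`, where `n`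
cannot occur twice because the trace is `2(n - 1)`.
-/

/-! ### A weighted sum of a decreasing sequence -/

/-- A weighted sum of a decreasing sequence, with weights in `[0, 1]` of total at most `2`, is
at most the sum of its first two terms. -/
theorem Antitone.sum_mul_le_add {n : ℕ} (hn : 2 ≤ n) {l c : Fin n → ℝ} (hl : Antitone l)
    (h0 : 0 ≤ l ⟨1, by omega⟩) (hc0 : ∀ i, 0 ≤ c i) (hc1 : ∀ i, c i ≤ 1) (hc : ∑ i, c i ≤ 2) :
    ∑ i, l i * c i ≤ l ⟨0, by omega⟩ + l ⟨1, by omega⟩ := by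
  have h01 : l ⟨1, by omega⟩ ≤ l ⟨0, by omega⟩ := hl (by simp)
  have key : ∀ i, l i * c i ≤ l ⟨1, by omega⟩ * c i +
      if i = ⟨0, by omega⟩ then l ⟨0, by omega⟩ - l ⟨1, by omega⟩ else 0 := by
    intro i
    split_ifs with h
    · subst h
      nlinarith [hc1 ⟨0, by omega⟩]
    · have hi : l i ≤ l ⟨1, by omega⟩ := hl (by
        rw [Fin.le_def]; rw [Fin.ext_iff] at h; simp at h ⊢; omega)
      have := mul_le_mul_of_nonneg_right hi (hc0 i)
      linarith
  refine (Finset.sum_le_sum fun i _ => key i).trans ?_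
  rw [Finset.sum_add_distrib, ← Finset.mul_sum, Finset.sum_ite_eq' Finset.univ]
  simp only [Finset.mem_univ, if_true]
  nlinarith

/-! ### Ky Fan's inequality for two singular values -/

namespace Matrix

/-- Bessel's inequality for two orthonormal vectors. -/
theorem sq_dotProduct_add_sq_dotProduct_le {E : Type*} [Fintype E] {f g : E → ℝ} (hf : f ⬝ᵥ f = 1)
    (hg : g ⬝ᵥ g = 1) (hfg : f ⬝ᵥ g = 0) (y : E → ℝ) :
    (y ⬝ᵥ f) ^ 2 + (y ⬝ᵥ g) ^ 2 ≤ y ⬝ᵥ y := by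
  have h := dotProduct_self_star_nonneg (y - (y ⬝ᵥ f) • f - (y ⬝ᵥ g) • g)
  simp only [star_trivial, sub_dotProduct, dotProduct_sub, smul_dotProduct, dotProduct_smul, hf,
    hg, hfg, dotProduct_comm g f, dotProduct_comm f y, dotProduct_comm g y, smul_eq_mul] at h
  linarith

/-- Bessel's inequality for a family of orthogonal vectors of norm at most `1`, zero vectors
being allowed. -/
theorem sum_sq_dotProduct_le {ι E : Type*} [Fintype ι] [Fintype E] [DecidableEq ι]
    {z : ι → E → ℝ} (h1 : ∀ i, z i ⬝ᵥ z i ≤ 1) (h0 : ∀ i j, i ≠ j → z i ⬝ᵥ z j = 0)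
    (f : E → ℝ) : ∑ i, (z i ⬝ᵥ f) ^ 2 ≤ f ⬝ᵥ f := by
  have h := dotProduct_self_star_nonneg (f - ∑ i, (z i ⬝ᵥ f) • z i)
  have e1 : (∑ i, (z i ⬝ᵥ f) • z i) ⬝ᵥ f = ∑ i, (z i ⬝ᵥ f) ^ 2 := by
    rw [sum_dotProduct]
    exact Finset.sum_congr rfl fun i _ => by rw [smul_dotProduct, smul_eq_mul, sq]
  have e2 : (∑ i, (z i ⬝ᵥ f) • z i) ⬝ᵥ (∑ i, (z i ⬝ᵥ f) • z i) ≤ ∑ i, (z i ⬝ᵥ f) ^ 2 := by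
    rw [sum_dotProduct]
    refine Finset.sum_le_sum fun i _ => ?_
    rw [dotProduct_sum, Finset.sum_eq_single i]
    · rw [smul_dotProduct, dotProduct_smul, smul_eq_mul, smul_eq_mul]
      nlinarith [h1 i, sq_nonneg (z i ⬝ᵥ f)]
    · intro j _ hj
      rw [smul_dotProduct, dotProduct_smul, h0 i j hj.symm]; simp
    · simp
  simp only [star_trivial, sub_dotProduct, dotProduct_sub] at h
  rw [dotProduct_comm f (∑ i, (z i ⬝ᵥ f) • z i), e1] at h
  linarith

variable {V E : Type*} [Fintype V] [DecidableEq V] [Fintype E] {A : Matrix V V ℝ}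

namespace IsHermitian

theorem exists_unit_eigenvector (hA : A.IsHermitian) (i : Fin (Fintype.card V)) :
    ∃ w : V → ℝ, w ⬝ᵥ w = 1 ∧ A *ᵥ w = hA.eigenvalues₀ i • w := by
  set j := Fintype.equivOfCardEq (Fintype.card_fin (Fintype.card V)) i with hj
  have hij : hA.eigenvalues j = hA.eigenvalues₀ i := by simp [eigenvalues, hj]
  refine ⟨hA.eigenvectorBasis j, ?_, ?_⟩
  · have h := hA.eigenvectorBasis.orthonormal.1 j
    have h2 : inner ℝ (hA.eigenvectorBasis j) (hA.eigenvectorBasis j) = 1 := by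
      rw [real_inner_self_eq_norm_sq, h]; norm_num
    rw [EuclideanSpace.inner_eq_star_dotProduct] at h2
    simpa using h2
  · rw [← hij]
    exact hA.mulVec_eigenvectorBasis j

theorem sum_eigenvalues₀ (hA : A.IsHermitian) : ∑ i, hA.eigenvalues₀ i = A.trace := by
  rw [hA.trace_eq_sum_eigenvalues]
  simp only [eigenvalues, RCLike.ofReal_real_eq_id, id]
  exact (Equiv.sum_comp (Fintype.equivOfCardEq (Fintype.card_fin _)).symm hA.eigenvalues₀).symm

/-- A lower bound `m` for all eigenvalues turns the trace into an upper bound for the sum of the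
two largest ones. -/
theorem eigenvalues₀_add_eigenvalues₀_le_of_le (hA : A.IsHermitian) (hn : 2 ≤ Fintype.card V)
    {m : ℝ} (hm : ∀ i, m ≤ hA.eigenvalues₀ i) :
    hA.eigenvalues₀ ⟨0, by omega⟩ + hA.eigenvalues₀ ⟨1, by omega⟩ +
      ((Fintype.card V : ℝ) - 2) * m ≤ A.trace := by
  rw [← hA.sum_eigenvalues₀]
  have key : ∑ i, (hA.eigenvalues₀ i - m) ≥
      ∑ i ∈ {(⟨0, by omega⟩ : Fin (Fintype.card V)), ⟨1, by omega⟩}, (hA.eigenvalues₀ i - m) :=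
    Finset.sum_le_sum_of_subset_of_nonneg (Finset.subset_univ _)
      fun i _ _ => sub_nonneg.2 (hm i)
  rw [Finset.sum_pair (by simp), Finset.sum_sub_distrib] at key
  simp at key
  linarith

theorem eigenvalues₀_nonneg_of_eq_mul_transpose (hA : A.IsHermitian) (B : Matrix V E ℝ)
    (hB : A = B * Bᵀ) (i) : 0 ≤ hA.eigenvalues₀ i := by
  obtain ⟨w, hw, hAw⟩ := hA.exists_unit_eigenvector i
  have h : w ⬝ᵥ (A *ᵥ w) = (Bᵀ *ᵥ w) ⬝ᵥ (Bᵀ *ᵥ w) := by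
    rw [hB, ← mulVec_mulVec, dotProduct_mulVec, ← mulVec_transpose]
  rw [hAw, dotProduct_smul, hw, smul_eq_mul, mul_one] at h
  rw [h]
  exact dotProduct_self_star_nonneg (Bᵀ *ᵥ w)

/-- Ky Fan's inequality on the side of `Bᵀ * B`, stated with the eigenvalues of `B * Bᵀ`. If `w i`
are the eigenvectors of `B * Bᵀ`, then the vectors `Bᵀ *ᵥ w i` are orthogonal with squared norms
the eigenvalues, so that `|B f|² + |B g|²` is a weighted sum of the eigenvalues to which
`Antitone.sum_mul_le_add` applies, by Bessel's inequality used in both directions. -/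
theorem mulVec_dotProduct_add_le_of_orthonormal (hA : A.IsHermitian) (hn : 2 ≤ Fintype.card V)
    (B : Matrix V E ℝ) (hB : A = B * Bᵀ) {f g : E → ℝ} (hf : f ⬝ᵥ f = 1) (hg : g ⬝ᵥ g = 1)
    (hfg : f ⬝ᵥ g = 0) :
    (B *ᵥ f) ⬝ᵥ (B *ᵥ f) + (B *ᵥ g) ⬝ᵥ (B *ᵥ g) ≤
      hA.eigenvalues₀ ⟨0, by omega⟩ + hA.eigenvalues₀ ⟨1, by omega⟩ := by
  set e : V ≃ Fin (Fintype.card V) :=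
    (Fintype.equivOfCardEq (Fintype.card_fin (Fintype.card V))).symm with he
  set l := hA.eigenvalues₀ with hl
  have hpos : ∀ i, 0 ≤ l i := hA.eigenvalues₀_nonneg_of_eq_mul_transpose B hB
  let w : Fin (Fintype.card V) → V → ℝ := fun i => hA.eigenvectorBasis (e.symm i)
  have hw : ∀ i j, w i ⬝ᵥ w j = if i = j then 1 else 0 := by
    intro i j
    have h := orthonormal_iff_ite.1 hA.eigenvectorBasis.orthonormal (e.symm j) (e.symm i)
    rw [EuclideanSpace.inner_eq_star_dotProduct] at h
    simpa [w, eq_comm] using h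
  have hAw : ∀ i, A *ᵥ w i = l i • w i := by
    intro i
    have := hA.mulVec_eigenvectorBasis (e.symm i)
    simpa [w, eigenvalues, he, hl] using this
  -- Parseval's identity in the eigenvector basis
  have hpars : ∀ x : V → ℝ, x ⬝ᵥ x = ∑ i, (w i ⬝ᵥ x) ^ 2 := by
    intro x
    have h := hA.eigenvectorBasis.sum_sq_norm_inner_right (WithLp.toLp 2 x)
    rw [← real_inner_self_eq_norm_sq, EuclideanSpace.inner_eq_star_dotProduct] at h
    rw [← Equiv.sum_comp e]
    simp only [star_trivial] at h
    rw [← h]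
    refine Finset.sum_congr rfl fun i _ => ?_
    rw [EuclideanSpace.inner_eq_star_dotProduct, Real.norm_eq_abs, sq_abs]
    simp [w, dotProduct_comm]
  let y : Fin (Fintype.card V) → E → ℝ := fun i => Bᵀ *ᵥ w i
  have hyx : ∀ i (x : E → ℝ), w i ⬝ᵥ (B *ᵥ x) = y i ⬝ᵥ x := by
    intro i x
    rw [dotProduct_mulVec, ← mulVec_transpose]
  have hyy : ∀ i j, y i ⬝ᵥ y j = if i = j then l i else 0 := by
    intro i j
    rw [← hyx, mulVec_mulVec, ← hB, hAw, dotProduct_smul, hw]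
    split_ifs with h
    · simp [h]
    · simp
  -- where the eigenvalue vanishes, the junk value `(√0)⁻¹ = 0` makes `z i` the zero vector
  let z : Fin (Fintype.card V) → E → ℝ := fun i => (√(l i))⁻¹ • y i
  have hz : ∀ i (x : E → ℝ), (y i ⬝ᵥ x) ^ 2 = l i * (z i ⬝ᵥ x) ^ 2 := by
    intro i x
    rcases (hpos i).eq_or_lt with h | h
    · have : y i = 0 := by
        have := hyy i i
        rw [if_pos rfl, ← h] at this
        exact dotProduct_self_eq_zero.1 this
      rw [this, ← h]; simp
    · simp only [z, smul_dotProduct, smul_eq_mul]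
      rw [mul_pow, inv_pow, Real.sq_sqrt h.le, mul_inv_cancel_left₀ h.ne']
  have hz1 : ∀ i, z i ⬝ᵥ z i ≤ 1 := by
    intro i
    simp only [z, smul_dotProduct, dotProduct_smul, smul_eq_mul, hyy, if_true]
    rcases (hpos i).eq_or_lt with h | h
    · rw [← h]; simp
    · rw [← mul_assoc, ← mul_inv, Real.mul_self_sqrt h.le, inv_mul_cancel₀ h.ne']
  have hz0 : ∀ i j, i ≠ j → z i ⬝ᵥ z j = 0 := by
    intro i j hij
    simp [z, hyy, hij]
  have hBx : ∀ x : E → ℝ, (B *ᵥ x) ⬝ᵥ (B *ᵥ x) = ∑ i, l i * (z i ⬝ᵥ x) ^ 2 := by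
    intro x
    rw [hpars]
    exact Finset.sum_congr rfl fun i _ => by rw [hyx, hz]
  rw [hBx, hBx, ← Finset.sum_add_distrib]
  simp only [← mul_add]
  refine hA.eigenvalues₀_antitone.sum_mul_le_add hn (hpos _) (fun i => by positivity)
    (fun i => (sq_dotProduct_add_sq_dotProduct_le hf hg hfg _).trans (hz1 i)) ?_
  rw [Finset.sum_add_distrib]
  have := sum_sq_dotProduct_le hz1 hz0 f
  have := sum_sq_dotProduct_le hz1 hz0 g
  linarith

theorem mulVec_dotProduct_div_add_le (hA : A.IsHermitian) (hn : 2 ≤ Fintype.card V)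
    (B : Matrix V E ℝ) (hB : A = B * Bᵀ) {f g : E → ℝ} (hf : 0 < f ⬝ᵥ f) (hg : 0 < g ⬝ᵥ g)
    (hfg : f ⬝ᵥ g = 0) :
    (B *ᵥ f) ⬝ᵥ (B *ᵥ f) / (f ⬝ᵥ f) + (B *ᵥ g) ⬝ᵥ (B *ᵥ g) / (g ⬝ᵥ g) ≤
      hA.eigenvalues₀ ⟨0, by omega⟩ + hA.eigenvalues₀ ⟨1, by omega⟩ := by
  have hinv : ∀ t : ℝ, 0 < t → (√t)⁻¹ * (√t)⁻¹ = t⁻¹ := fun t ht => by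
    rw [← mul_inv, Real.mul_self_sqrt ht.le]
  have hunit : ∀ x : E → ℝ, 0 < x ⬝ᵥ x →
      ((√(x ⬝ᵥ x))⁻¹ • x) ⬝ᵥ ((√(x ⬝ᵥ x))⁻¹ • x) = 1 := fun x hx => by
    rw [smul_dotProduct, dotProduct_smul, smul_eq_mul, smul_eq_mul, ← mul_assoc, hinv _ hx,
      inv_mul_cancel₀ hx.ne']
  have h := hA.mulVec_dotProduct_add_le_of_orthonormal hn B hB (hunit f hf) (hunit g hg)
    (by rw [smul_dotProduct, dotProduct_smul, hfg]; simp)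
  simp only [mulVec_smul, smul_dotProduct, dotProduct_smul, smul_eq_mul, ← mul_assoc,
    hinv _ hf, hinv _ hg] at h
  rwa [div_eq_inv_mul, div_eq_inv_mul]

end IsHermitian

end Matrix

namespace SimpleGraph

open Matrix

/-! ### Incidence matrix and signless Laplacian -/

section Spectrum

variable {V : Type*} [Fintype V] [DecidableEq V] (G : SimpleGraph V) [DecidableRel G.Adj]

theorem signlessLapMatrix_apply (x y : V) : G.signlessLapMatrix x y =
    if x = y then (G.degree x : ℝ) else if G.Adj x y then 1 else 0 := by
  by_cases h : x = y
  · subst h; simp [signlessLapMatrix, degMatrix]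
  · simp [signlessLapMatrix, degMatrix, h]

theorem signlessLapMatrix_eq_mul_transpose :
    G.signlessLapMatrix = G.incMatrix ℝ * (G.incMatrix ℝ)ᵀ := by
  rw [incMatrix_mul_transpose]
  ext x y
  simp [signlessLapMatrix_apply]

theorem incMatrix_dotProduct (x y : V) :
    G.incMatrix ℝ x ⬝ᵥ G.incMatrix ℝ y = G.signlessLapMatrix x y := by
  rw [signlessLapMatrix_eq_mul_transpose]; rfl

theorem incMatrix_mulVec_row (u : V) : G.incMatrix ℝ *ᵥ G.incMatrix ℝ u =
    (G.degree u : ℝ) • Pi.single u 1 + G.adjMatrix ℝ u := by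
  ext x
  change G.incMatrix ℝ x ⬝ᵥ G.incMatrix ℝ u = _
  rw [incMatrix_dotProduct, signlessLapMatrix_apply]
  by_cases h : x = u
  · subst h; simp
  · simp [h, G.adj_comm x u]

theorem incMatrix_mulVec_single {u v : V} (h : G.Adj u v) :
    G.incMatrix ℝ *ᵥ Pi.single s(u, v) 1 = Pi.single u 1 + Pi.single v 1 := by
  ext x
  have := h.ne
  rw [mulVec_single_one, col_apply, incMatrix_apply']
  simp only [mk'_mem_incidenceSet_iff, h, true_and, Pi.add_apply, Pi.single_apply]
  by_cases h1 : x = u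
  · subst h1; simp [this]
  · simp [h1]

theorem incMatrix_row_dotProduct_single {u v : V} (h : G.Adj u v) (x : V) :
    G.incMatrix ℝ x ⬝ᵥ Pi.single s(u, v) 1 = if x = u ∨ x = v then 1 else 0 := by
  rw [dotProduct_single_one, incMatrix_apply']
  simp only [mk'_mem_incidenceSet_iff, h, true_and]

theorem adjMatrix_row_dotProduct (u v : V) :
    G.adjMatrix ℝ u ⬝ᵥ G.adjMatrix ℝ v =
      ((G.neighborFinset u ∩ G.neighborFinset v).card : ℝ) := by
  have h : G.neighborFinset u ∩ G.neighborFinset v =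
      Finset.univ.filter fun x => G.Adj u x ∧ G.Adj v x := by ext x; simp
  rw [h, ← Finset.sum_boole]
  refine Finset.sum_congr rfl fun x _ => ?_
  by_cases h1 : G.Adj u x <;> simp [h1]

theorem signlessLapEigenvalue_nonneg (i : Fin (Fintype.card V)) : 0 ≤ G.signlessLapEigenvalue i :=
  G.isHermitian_signlessLapMatrix.eigenvalues₀_nonneg_of_eq_mul_transpose _
    G.signlessLapMatrix_eq_mul_transpose i

/-- Ky Fan's inequality on the edge side. Test vectors are functions on all of `Sym2 V`; the
columns of `incMatrix` at pairs that are not edges vanish. -/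
theorem rayleigh_add_le_signlessLapEigenvalue (hn : 2 ≤ Fintype.card V) {f g : Sym2 V → ℝ}
    (hf : 0 < f ⬝ᵥ f) (hg : 0 < g ⬝ᵥ g) (hfg : f ⬝ᵥ g = 0) :
    (G.incMatrix ℝ *ᵥ f) ⬝ᵥ (G.incMatrix ℝ *ᵥ f) / (f ⬝ᵥ f) +
      (G.incMatrix ℝ *ᵥ g) ⬝ᵥ (G.incMatrix ℝ *ᵥ g) / (g ⬝ᵥ g) ≤
      G.signlessLapEigenvalue ⟨0, by omega⟩ + G.signlessLapEigenvalue ⟨1, by omega⟩ :=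
  G.isHermitian_signlessLapMatrix.mulVec_dotProduct_div_add_le hn _
    G.signlessLapMatrix_eq_mul_transpose hf hg hfg

theorem incMatrix_row_dotProduct_self (u : V) :
    G.incMatrix ℝ u ⬝ᵥ G.incMatrix ℝ u = G.degree u := by
  rw [incMatrix_dotProduct, signlessLapMatrix_apply, if_pos rfl]

theorem incMatrix_mulVec_row_dotProduct_self (u : V) :
    (G.incMatrix ℝ *ᵥ G.incMatrix ℝ u) ⬝ᵥ (G.incMatrix ℝ *ᵥ G.incMatrix ℝ u) =
      (G.degree u : ℝ) ^ 2 + G.degree u := by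
  rw [incMatrix_mulVec_row]
  simp only [add_dotProduct, dotProduct_add, smul_dotProduct, dotProduct_smul,
    single_one_dotProduct, dotProduct_single_one, adjMatrix_row_dotProduct]
  simp [sq]

/-! ### Lower bounds for the sum of the two largest eigenvalues -/

/-- The test vectors are the indicators of the edges at `u` and of the edges at `v`. -/
theorem degree_add_degree_add_two_le (hn : 2 ≤ Fintype.card V) {u v : V} (huv : u ≠ v)
    (h : ¬ G.Adj u v) (hu : 0 < G.degree u) (hv : 0 < G.degree v) :
    (G.degree u : ℝ) + G.degree v + 2 ≤
      G.signlessLapEigenvalue ⟨0, by omega⟩ + G.signlessLapEigenvalue ⟨1, by omega⟩ := by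
  have hu' : (0 : ℝ) < G.degree u := by exact_mod_cast hu
  have hv' : (0 : ℝ) < G.degree v := by exact_mod_cast hv
  have key := G.rayleigh_add_le_signlessLapEigenvalue hn (f := G.incMatrix ℝ u)
    (g := G.incMatrix ℝ v) (by rwa [incMatrix_row_dotProduct_self])
    (by rwa [incMatrix_row_dotProduct_self])
    (by rw [incMatrix_dotProduct, signlessLapMatrix_apply, if_neg huv, if_neg h])
  simp only [incMatrix_row_dotProduct_self, incMatrix_mulVec_row_dotProduct_self] at key
  refine le_trans (le_of_eq ?_) key
  field_simp
  ring

/-- The test vectors are the indicator of the edges at `u` and the difference of two of these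
edges. -/
theorem degree_add_two_le (hn : 2 ≤ Fintype.card V) {u v w : V} (hvw : v ≠ w)
    (hv : G.Adj u v) (hw : G.Adj u w) :
    (G.degree u : ℝ) + 2 ≤
      G.signlessLapEigenvalue ⟨0, by omega⟩ + G.signlessLapEigenvalue ⟨1, by omega⟩ := by
  have hu' : (0 : ℝ) < G.degree u := by
    exact_mod_cast (G.degree_pos_iff_exists_adj u).2 ⟨v, hv⟩
  have hne : s(u, v) ≠ s(u, w) := fun h => hvw (Sym2.congr_right.1 h)
  have hgg : (Pi.single s(u, v) 1 - Pi.single s(u, w) 1 : Sym2 V → ℝ) ⬝ᵥ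
      (Pi.single s(u, v) 1 - Pi.single s(u, w) 1) = 2 := by
    simp only [sub_dotProduct, dotProduct_sub, single_one_dotProduct, Pi.single_apply]
    simp only [hne, hne.symm, if_true, if_false]; norm_num
  have key := G.rayleigh_add_le_signlessLapEigenvalue hn (f := G.incMatrix ℝ u)
    (g := Pi.single s(u, v) 1 - Pi.single s(u, w) 1)
    (by rwa [incMatrix_row_dotProduct_self])
    (by rw [hgg]; norm_num)
    (by rw [dotProduct_sub, incMatrix_row_dotProduct_single _ hv,
          incMatrix_row_dotProduct_single _ hw]; simp)
  have hMg : (G.incMatrix ℝ *ᵥ (Pi.single s(u, v) 1 - Pi.single s(u, w) 1)) ⬝ᵥ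
      (G.incMatrix ℝ *ᵥ (Pi.single s(u, v) 1 - Pi.single s(u, w) 1)) = 2 := by
    rw [mulVec_sub, incMatrix_mulVec_single _ hv, incMatrix_mulVec_single _ hw,
      add_sub_add_left_eq_sub]
    simp only [sub_dotProduct, dotProduct_sub, single_one_dotProduct, Pi.single_apply]
    simp [hvw, hvw.symm]; norm_num
  rw [hgg, hMg, incMatrix_row_dotProduct_self, incMatrix_mulVec_row_dotProduct_self] at key
  refine le_trans (le_of_eq ?_) key
  field_simp
  ring

/-- Let `e` be the edge `uv` and `f_u`, `f_v` the indicators of the `a` other edges at `u` and the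
`b` other edges at `v`. On the span of `f_u`, `e`, `f_v`, where the compression of `Mᵀ * M` has
trace `a + b + 4`, the vector `z = f_u + f_v - (a + b) e` has Rayleigh quotient
`1 - 2 (a b - c) / ((a + b) (a + b + 1))`. The test vectors `b f_u - a f_v` and `f_u + f_v + e`
span the orthogonal complement of `z`. -/
theorem degree_add_degree_add_one_add_le (hn : 2 ≤ Fintype.card V) {u v : V} {a b : ℝ}
    (h : G.Adj u v) (hu : (G.degree u : ℝ) = a + 1) (hv : (G.degree v : ℝ) = b + 1)
    (ha : 0 < a) (hb : 0 < b) :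
    (G.degree u : ℝ) + G.degree v + 1 +
      2 * (a * b - (G.neighborFinset u ∩ G.neighborFinset v).card) / ((a + b) * (a + b + 1)) ≤
      G.signlessLapEigenvalue ⟨0, by omega⟩ + G.signlessLapEigenvalue ⟨1, by omega⟩ := by
  set c : ℝ := ((G.neighborFinset u ∩ G.neighborFinset v).card : ℝ) with hc
  have huu := G.incMatrix_row_dotProduct_self u
  have hvv := G.incMatrix_row_dotProduct_self v
  have huv : G.incMatrix ℝ u ⬝ᵥ G.incMatrix ℝ v = 1 := by
    rw [incMatrix_dotProduct, signlessLapMatrix_apply, if_neg h.ne, if_pos h]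
  have hue : G.incMatrix ℝ u ⬝ᵥ Pi.single s(u, v) 1 = 1 := by
    rw [incMatrix_row_dotProduct_single _ h]; simp
  have hve : G.incMatrix ℝ v ⬝ᵥ Pi.single s(u, v) 1 = 1 := by
    rw [incMatrix_row_dotProduct_single _ h]; simp
  have hee : (Pi.single s(u, v) 1 : Sym2 V → ℝ) ⬝ᵥ Pi.single s(u, v) 1 = 1 := by simp
  have Huu := G.incMatrix_mulVec_row_dotProduct_self u
  have Hvv := G.incMatrix_mulVec_row_dotProduct_self v
  have Huv : (G.incMatrix ℝ *ᵥ G.incMatrix ℝ u) ⬝ᵥ (G.incMatrix ℝ *ᵥ G.incMatrix ℝ v) =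
      a + b + 2 + c := by
    simp only [incMatrix_mulVec_row, add_dotProduct, dotProduct_add, smul_dotProduct,
      dotProduct_smul, single_one_dotProduct, dotProduct_single_one, adjMatrix_row_dotProduct]
    simp [h.ne, h, h.symm, hu, hv, hc]; ring
  have Hue : (G.incMatrix ℝ *ᵥ G.incMatrix ℝ u) ⬝ᵥ (G.incMatrix ℝ *ᵥ Pi.single s(u, v) 1) =
      a + 2 := by
    rw [incMatrix_mulVec_row, incMatrix_mulVec_single _ h]
    simp only [dotProduct_add, dotProduct_single_one]
    simp [h, hu, h.ne']; ring
  have Hve : (G.incMatrix ℝ *ᵥ G.incMatrix ℝ v) ⬝ᵥ (G.incMatrix ℝ *ᵥ Pi.single s(u, v) 1) =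
      b + 2 := by
    rw [incMatrix_mulVec_row, incMatrix_mulVec_single _ h]
    simp only [dotProduct_add, dotProduct_single_one]
    simp [h.ne, h.symm, hv]; ring
  have Hee : (G.incMatrix ℝ *ᵥ Pi.single s(u, v) 1) ⬝ᵥ (G.incMatrix ℝ *ᵥ Pi.single s(u, v) 1) =
      2 := by
    rw [incMatrix_mulVec_single _ h]
    simp only [dotProduct_add, dotProduct_single_one]
    simp [h.ne, h.ne']; norm_num
  rw [hu] at huu Huu
  rw [hv] at hvv Hvv
  -- `p = f_u + e` and `q = f_v + e` in the notation of the docstring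
  set p := G.incMatrix ℝ u
  set q := G.incMatrix ℝ v
  set e : Sym2 V → ℝ := Pi.single s(u, v) 1
  set M := G.incMatrix ℝ
  have hff : (b • p - a • q + (a - b) • e) ⬝ᵥ (b • p - a • q + (a - b) • e) =
      a * b * (a + b) := by
    simp only [add_dotProduct, dotProduct_add, sub_dotProduct, dotProduct_sub, smul_dotProduct,
      dotProduct_smul, smul_eq_mul, dotProduct_comm q p, dotProduct_comm e p,
      dotProduct_comm e q, huu, hvv, huv, hue, hve, hee]
    ring
  have hgg : (p + q - e) ⬝ᵥ (p + q - e) = a + b + 1 := by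
    simp only [add_dotProduct, dotProduct_add, sub_dotProduct, dotProduct_sub,
      dotProduct_comm q p, dotProduct_comm e p,
      dotProduct_comm e q, huu, hvv, huv, hue, hve, hee]
    ring
  have hfg : (b • p - a • q + (a - b) • e) ⬝ᵥ (p + q - e) = 0 := by
    simp only [add_dotProduct, dotProduct_add, sub_dotProduct, dotProduct_sub, smul_dotProduct,
      smul_eq_mul, dotProduct_comm q p, dotProduct_comm e p,
      dotProduct_comm e q, huu, hvv, huv, hue, hve, hee]
    ring
  have hMf : (M *ᵥ (b • p - a • q + (a - b) • e)) ⬝ᵥ (M *ᵥ (b • p - a • q + (a - b) • e)) =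
      a * b * (2 * a * b + a + b - 2 * c) := by
    simp only [mulVec_add, mulVec_sub, mulVec_smul, add_dotProduct, dotProduct_add,
      sub_dotProduct, dotProduct_sub, smul_dotProduct, dotProduct_smul, smul_eq_mul,
      dotProduct_comm (M *ᵥ q) (M *ᵥ p), dotProduct_comm (M *ᵥ e) (M *ᵥ p),
      dotProduct_comm (M *ᵥ e) (M *ᵥ q), Huu, Hvv, Huv, Hue, Hve, Hee]
    ring
  have hMg : (M *ᵥ (p + q - e)) ⬝ᵥ (M *ᵥ (p + q - e)) =
      a ^ 2 + b ^ 2 + 3 * a + 3 * b + 2 + 2 * c := by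
    simp only [mulVec_add, mulVec_sub, add_dotProduct, dotProduct_add,
      sub_dotProduct, dotProduct_sub,
      dotProduct_comm (M *ᵥ q) (M *ᵥ p), dotProduct_comm (M *ᵥ e) (M *ᵥ p),
      dotProduct_comm (M *ᵥ e) (M *ᵥ q), Huu, Hvv, Huv, Hue, Hve, Hee]
    ring
  have key := G.rayleigh_add_le_signlessLapEigenvalue hn (by rw [hff]; positivity)
    (by rw [hgg]; positivity) hfg
  change (M *ᵥ _) ⬝ᵥ (M *ᵥ _) / _ + (M *ᵥ _) ⬝ᵥ (M *ᵥ _) / _ ≤ _ at key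
  rw [hff, hgg, hMf, hMg] at key
  refine le_trans (le_of_eq ?_) key
  rw [hu, hv]
  field_simp
  ring

end Spectrum

/-! ### Connected graphs with small degrees -/

section Connected

variable {V : Type*} {G : SimpleGraph V}

theorem Connected.mem_of_adj_closed (hG : G.Connected) {S : Set V}
    {u : V} (hu : u ∈ S) (hS : ∀ x ∈ S, ∀ y, G.Adj x y → y ∈ S) (y : V) : y ∈ S := by
  obtain ⟨p⟩ := hG.preconnected u y
  induction p with
  | nil => exact hu
  | cons h _ ih => exact ih (hS _ hu _ h)

variable [Fintype V] [DecidableEq V] [DecidableRel G.Adj]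

/-- The closed neighbourhood of `u` is closed under adjacency, since each neighbour of `u` has no
other neighbour. -/
theorem Connected.eq_starGraph (hG : G.Connected) {u : V}
    (h : ∀ w, w ≠ u → G.degree w ≤ 1) : G = starGraph u := by
  have hleaf : ∀ w y z, w ≠ u → G.Adj w y → G.Adj w z → y = z := fun w y z hw hy hz =>
    Finset.card_le_one.1 (h w hw) y (by simpa using hy) z (by simpa using hz)
  have hall : ∀ y, y = u ∨ G.Adj u y :=
    hG.mem_of_adj_closed (S := {y | y = u ∨ G.Adj u y}) (u := u) (Or.inl rfl) (by
      rintro x (rfl | hx) y hxy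
      · exact Or.inr hxy
      · exact Or.inl (hleaf x y u hx.ne' hxy hx.symm))
  ext x y
  rw [starGraph_adj]
  constructor
  · intro hxy
    refine ⟨hxy.ne, ?_⟩
    by_contra! hc
    exact hc.2 (hleaf x y u hc.1 hxy ((hall x).resolve_left hc.1).symm)
  · rintro ⟨hne, rfl | rfl⟩
    · exact (hall y).resolve_left hne.symm
    · exact ((hall x).resolve_left hne).symm

theorem Connected.nonempty_iso_top_fin_three (hG : G.Connected) (hd : ∀ x, G.degree x ≤ 2)
    {u v w : V} (huv : G.Adj u v) (huw : G.Adj u w) (hvw : G.Adj v w) :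
    Nonempty (G ≃g (⊤ : SimpleGraph (Fin 3))) := by
  have hnb : ∀ x y z, y ≠ z → G.Adj x y → G.Adj x z → ∀ t, G.Adj x t → t = y ∨ t = z := by
    intro x y z hyz hy hz t ht
    by_contra! hc
    have h3 : ({t, y, z} : Finset V).card ≤ G.degree x :=
      Finset.card_le_card (by intro s; simp; rintro (rfl | rfl | rfl) <;> assumption)
    rw [Finset.card_eq_three.2 ⟨t, y, z, hc.1, hc.2, hyz, rfl⟩] at h3
    have := hd x
    omega
  have hall : ∀ y, y ∈ ({u, v, w} : Set V) := hG.mem_of_adj_closed (u := u) (by simp) (by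
    rintro x (rfl | rfl | rfl) t ht
    · rcases hnb _ _ _ hvw.ne huv huw t ht with rfl | rfl <;> simp
    · rcases hnb _ _ _ huw.ne huv.symm hvw t ht with rfl | rfl <;> simp
    · rcases hnb _ _ _ huv.ne huw.symm hvw.symm t ht with rfl | rfl <;> simp)
  have hcard : Fintype.card V = 3 := by
    rw [← Finset.card_univ, Finset.card_eq_three]
    exact ⟨u, v, w, huv.ne, huw.ne, hvw.ne, by ext y; simpa using hall y⟩
  have htop : ∀ x y, x ≠ y → G.Adj x y := by
    intro x y hxy
    rcases hall x with rfl | rfl | rfl <;> rcases hall y with rfl | rfl | rfl <;>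
      first | exact absurd rfl hxy | assumption | (apply SimpleGraph.Adj.symm; assumption)
  refine ⟨⟨Fintype.equivFinOfCardEq hcard, ?_⟩⟩
  intro x y
  simp only [top_adj, ne_eq, EmbeddingLike.apply_eq_iff_eq]
  exact ⟨htop x y, Adj.ne⟩

end Connected

variable {V : Type*} [Fintype V] [DecidableEq V] (G : SimpleGraph V) [DecidableRel G.Adj]

/-! ### The two largest degrees -/

theorem exists_degreeSequence_eq (hn : 2 ≤ Fintype.card V) : ∃ u v : V, u ≠ v ∧
    G.degreeSequence ⟨0, by omega⟩ = G.degree u ∧ G.degreeSequence ⟨1, by omega⟩ = G.degree v ∧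
    (∀ x, G.degree x ≤ G.degree u) ∧ ∀ x, x ≠ u → G.degree x ≤ G.degree v := by
  obtain ⟨u, -, hu⟩ := Finset.exists_max_image (Finset.univ : Finset V) (G.degree ·)
    (Finset.card_pos.1 (by rw [Finset.card_univ]; omega))
  obtain ⟨v, hv, hvmax⟩ := Finset.exists_max_image (Finset.univ.erase u) (G.degree ·)
    (Finset.card_pos.1 (by rw [Finset.card_erase_of_mem (by simp), Finset.card_univ]; omega))
  have hlist : G.degreeList = G.degree u :: G.degree v ::
      ((((Finset.univ : Finset V).erase u).erase v).val.map fun x => G.degree x).sort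
        (· ≥ ·) := by
    have h1 : (Finset.univ : Finset V).val =
        u ::ₘ v ::ₘ ((Finset.univ.erase u).erase v).val := by
      rw [Finset.erase_val _ v, Multiset.cons_erase hv, Finset.erase_val,
        Multiset.cons_erase (Finset.mem_univ u)]
    rw [degreeList, h1, Multiset.map_cons, Multiset.map_cons, Multiset.sort_cons,
      Multiset.sort_cons]
    · intro b hb
      obtain ⟨x, hx, rfl⟩ := Multiset.mem_map.1 hb
      exact hvmax x (Finset.mem_of_mem_erase hx)
    · intro b hb
      rcases Multiset.mem_cons.1 hb with rfl | hb
      · exact hu v (Finset.mem_univ v)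
      · obtain ⟨x, -, rfl⟩ := Multiset.mem_map.1 hb
        exact hu x (Finset.mem_univ x)
  refine ⟨u, v, (Finset.ne_of_mem_erase hv).symm, ?_, ?_, fun x => hu x (Finset.mem_univ x),
    fun x hx => hvmax x (by simp [hx])⟩
  · simp [degreeSequence, hlist]
  · simp [degreeSequence, hlist]

/-! ### Upper bounds for complete graphs on three vertices and for stars -/

theorem trace_signlessLapMatrix : G.signlessLapMatrix.trace = ∑ x, (G.degree x : ℝ) := by
  simp [trace, signlessLapMatrix_apply]

theorem signlessLapMatrix_mulVec_apply (x : V) (w : V → ℝ) :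
    (G.signlessLapMatrix *ᵥ w) x = G.degree x * w x + ∑ y ∈ G.neighborFinset x, w y := by
  rw [signlessLapMatrix, add_mulVec, Pi.add_apply, adjMatrix_mulVec_apply, degMatrix,
    mulVec_diagonal]

theorem signlessLapEigenvalue_add_le (hn : 2 ≤ Fintype.card V) {m : ℝ}
    (hm : ∀ i, m ≤ G.signlessLapEigenvalue i) :
    G.signlessLapEigenvalue ⟨0, by omega⟩ + G.signlessLapEigenvalue ⟨1, by omega⟩ +
      ((Fintype.card V : ℝ) - 2) * m ≤ ∑ x, (G.degree x : ℝ) := by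
  rw [← trace_signlessLapMatrix]
  exact G.isHermitian_signlessLapMatrix.eigenvalues₀_add_eigenvalues₀_le_of_le hn hm

variable {G}

theorem neighborFinset_eq_univ_erase (h : ∀ x y, x ≠ y → G.Adj x y) (x : V) :
    G.neighborFinset x = Finset.univ.erase x := by
  ext y
  simp only [mem_neighborFinset, Finset.mem_erase, Finset.mem_univ, and_true]
  exact ⟨fun h => h.ne', fun hy => h x y hy.symm⟩

theorem degree_of_forall_adj (h : ∀ x y, x ≠ y → G.Adj x y) (x : V) :
    G.degree x = Fintype.card V - 1 := by
  rw [← card_neighborFinset_eq_degree, neighborFinset_eq_univ_erase h,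
    Finset.card_erase_of_mem (Finset.mem_univ x), Finset.card_univ]

theorem signlessLapEigenvalue_add_le_five (hcard : Fintype.card V = 3)
    (h : ∀ x y, x ≠ y → G.Adj x y) :
    G.signlessLapEigenvalue ⟨0, by omega⟩ + G.signlessLapEigenvalue ⟨1, by omega⟩ ≤ 5 := by
  have hnb := fun x => neighborFinset_eq_univ_erase h x
  have hdeg : ∀ x, G.degree x = 2 := fun x => by rw [degree_of_forall_adj h, hcard]
  have h1 : ∀ i, 1 ≤ G.signlessLapEigenvalue i := by
    intro i
    obtain ⟨w, hw, hQw⟩ := G.isHermitian_signlessLapMatrix.exists_unit_eigenvector i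
    -- `Q = I + J` with `J` the all-ones matrix
    have hQ : G.signlessLapMatrix *ᵥ w = w + fun _ => ∑ y, w y := by
      ext x
      rw [signlessLapMatrix_mulVec_apply, hnb, hdeg, Pi.add_apply,
        ← Finset.add_sum_erase _ _ (Finset.mem_univ x)]
      push_cast
      ring
    have h2 : w ⬝ᵥ (G.signlessLapMatrix *ᵥ w) = G.signlessLapEigenvalue i := by
      rw [hQw, dotProduct_smul, hw]; simp [signlessLapEigenvalue]
    rw [hQ, dotProduct_add, hw] at h2
    have h3 : w ⬝ᵥ (fun _ => ∑ y, w y) = (∑ y, w y) ^ 2 := by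
      simp only [dotProduct]; rw [← Finset.sum_mul, sq]
    nlinarith [sq_nonneg (∑ y, w y)]
  have := G.signlessLapEigenvalue_add_le (by omega) h1
  simp [hdeg, hcard] at this
  linarith

theorem neighborFinset_eq_of_eq_starGraph {c : V} (hG : G = starGraph c) (x : V) :
    G.neighborFinset x = if x = c then Finset.univ.erase c else {c} := by
  subst hG
  ext y
  rw [mem_neighborFinset, starGraph_adj]
  split_ifs with h
  · subst h; simp [eq_comm]
  · simp only [h, false_or, Finset.mem_singleton, and_iff_right_iff_imp]
    rintro rfl; exact h

theorem degree_eq_of_eq_starGraph {c : V} (hG : G = starGraph c) (x : V) :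
    G.degree x = if x = c then Fintype.card V - 1 else 1 := by
  rw [← card_neighborFinset_eq_degree, neighborFinset_eq_of_eq_starGraph hG]
  split_ifs with h
  · rw [Finset.card_erase_of_mem (Finset.mem_univ c), Finset.card_univ]
  · simp

theorem signlessLapEigenvalue_of_eq_starGraph {c : V} (hG : G = starGraph c)
    (i : Fin (Fintype.card V)) : G.signlessLapEigenvalue i = 0 ∨ G.signlessLapEigenvalue i = 1 ∨
      G.signlessLapEigenvalue i = Fintype.card V := by
  obtain ⟨w, hw, hQw⟩ := G.isHermitian_signlessLapMatrix.exists_unit_eigenvector i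
  change _ = G.signlessLapEigenvalue i • w at hQw
  set l := G.signlessLapEigenvalue i
  by_cases hl1 : l = 1
  · exact Or.inr (Or.inl hl1)
  have hn : 0 < Fintype.card V := Fintype.card_pos_iff.2 ⟨c⟩
  have hl : ∀ x, (G.degree x : ℝ) * w x + ∑ y ∈ G.neighborFinset x, w y = l * w x := by
    intro x
    rw [← signlessLapMatrix_mulVec_apply, hQw]; rfl
  have hleaf : ∀ x, x ≠ c → (l - 1) * w x = w c := by
    intro x hx
    have := hl x
    rw [degree_eq_of_eq_starGraph hG, neighborFinset_eq_of_eq_starGraph hG, if_neg hx,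
      if_neg hx] at this
    simp at this
    linarith
  have hc := hl c
  rw [degree_eq_of_eq_starGraph hG, neighborFinset_eq_of_eq_starGraph hG, if_pos rfl,
    if_pos rfl, Nat.cast_sub hn] at hc
  have hsum : (l - 1) * ∑ y ∈ Finset.univ.erase c, w y = ((Fintype.card V : ℝ) - 1) * w c := by
    rw [Finset.mul_sum, Finset.sum_congr rfl fun x hx => hleaf x (Finset.ne_of_mem_erase hx),
      Finset.sum_const, Finset.card_erase_of_mem (Finset.mem_univ c), Finset.card_univ,
      nsmul_eq_mul, Nat.cast_sub hn, Nat.cast_one]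
  have hwc : w c ≠ 0 := by
    intro h0
    have : w = 0 := by
      ext x
      by_cases hx : x = c
      · rw [hx, h0]; rfl
      · have := hleaf x hx
        rw [h0] at this
        exact (mul_eq_zero.1 this).resolve_left (sub_ne_zero.2 hl1)
    rw [this] at hw
    simp at hw
  -- substituting the leaf equations into the equation at the centre
  have h3 : (l * (l - Fintype.card V)) * w c = 0 := by
    push_cast at hc
    linear_combination (-(l - 1)) * hc + hsum
  rcases mul_eq_zero.1 ((mul_eq_zero.1 h3).resolve_right hwc) with h | h
  · exact Or.inl h
  · exact Or.inr (Or.inr (sub_eq_zero.1 h))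

theorem signlessLapEigenvalue_add_le_of_eq_starGraph (hn : 2 ≤ Fintype.card V) {c : V}
    (hG : G = starGraph c) :
    G.signlessLapEigenvalue ⟨0, by omega⟩ + G.signlessLapEigenvalue ⟨1, by omega⟩ ≤
      Fintype.card V + 1 := by
  have hn' : (2 : ℝ) ≤ Fintype.card V := by exact_mod_cast hn
  have htr := G.signlessLapEigenvalue_add_le hn G.signlessLapEigenvalue_nonneg
  have hsum : ∑ x, (G.degree x : ℝ) = 2 * ((Fintype.card V : ℝ) - 1) := by
    rw [← Finset.add_sum_erase _ _ (Finset.mem_univ c),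
      Finset.sum_congr rfl fun x hx => by
        rw [degree_eq_of_eq_starGraph hG, if_neg (Finset.ne_of_mem_erase hx)],
      degree_eq_of_eq_starGraph hG, if_pos rfl, Finset.sum_const,
      Finset.card_erase_of_mem (Finset.mem_univ c), Finset.card_univ, nsmul_eq_mul,
      Nat.cast_sub (by omega)]
    push_cast
    ring
  rw [hsum] at htr
  -- the trace bound excludes that both eigenvalues are `Fintype.card V`
  rcases signlessLapEigenvalue_of_eq_starGraph hG ⟨0, by omega⟩ with h | h | h <;>
    rcases signlessLapEigenvalue_of_eq_starGraph hG ⟨1, by omega⟩ with h' | h' | h' <;>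
    rw [h, h'] at htr ⊢ <;> linarith

end SimpleGraph

/-! ### The inequality and its equality case -/

open SimpleGraph in
theorem theorem2 {V : Type*} [Fintype V] [DecidableEq V] (G : SimpleGraph V)
    [DecidableRel G.Adj] (hG : G.Connected) (hn : 3 ≤ Fintype.card V) :
    ((G.degreeSequence ⟨0, by omega⟩ : ℝ) + (G.degreeSequence ⟨1, by omega⟩ : ℝ) + 1 ≤
        G.signlessLapEigenvalue ⟨0, by omega⟩ + G.signlessLapEigenvalue ⟨1, by omega⟩) ∧
      (G.signlessLapEigenvalue ⟨0, by omega⟩ + G.signlessLapEigenvalue ⟨1, by omega⟩ =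
          (G.degreeSequence ⟨0, by omega⟩ : ℝ) + (G.degreeSequence ⟨1, by omega⟩ : ℝ) + 1 ↔
        Nonempty (G ≃g (⊤ : SimpleGraph (Fin 3))) ∨ ∃ c : V, G = SimpleGraph.starGraph c) := by
  obtain ⟨u, v, huv, h0, h1, hu, hv⟩ := G.exists_degreeSequence_eq (by omega)
  rw [h0, h1]
  have : Nontrivial V := ⟨u, v, huv⟩
  have hdeg : ∀ x, 0 < G.degree x := fun x => hG.preconnected.degree_pos_of_nontrivial x
  have hvu := hu v
  have main : ((G.degree u : ℝ) + G.degree v + 1 ≤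
        G.signlessLapEigenvalue ⟨0, by omega⟩ + G.signlessLapEigenvalue ⟨1, by omega⟩) ∧
      (G.signlessLapEigenvalue ⟨0, by omega⟩ + G.signlessLapEigenvalue ⟨1, by omega⟩ =
          (G.degree u : ℝ) + G.degree v + 1 →
        Nonempty (G ≃g (⊤ : SimpleGraph (Fin 3))) ∨ ∃ c : V, G = SimpleGraph.starGraph c) := by
    by_cases hadj : G.Adj u v
    swap
    · have := G.degree_add_degree_add_two_le (by omega) huv hadj (hdeg u) (hdeg v)
      exact ⟨by linarith, fun h => by linarith⟩
    rcases Nat.lt_or_ge (G.degree v) 2 with hv2 | hv2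
    · have hv1 : G.degree v = 1 := by have := hdeg v; omega
      have hstar : G = starGraph u :=
        hG.eq_starGraph fun w hw => by have := hv w hw; omega
      refine ⟨?_, fun _ => Or.inr ⟨u, hstar⟩⟩
      obtain ⟨w, hw⟩ : ∃ w, w ∉ ({u, v} : Finset V) := by
        by_contra! hc
        have := Finset.card_le_card (fun x _ => hc x : (Finset.univ : Finset V) ⊆ {u, v})
        rw [Finset.card_univ, Finset.card_pair huv] at this
        omega
      simp only [Finset.mem_insert, Finset.mem_singleton, not_or] at hw
      have huw : G.Adj u w := by
        have h : (starGraph u).Adj u w := starGraph_center_adj (Ne.symm hw.1)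
        rwa [← hstar] at h
      have := G.degree_add_two_le (by omega) (Ne.symm hw.2) hadj huw
      rw [hv1]
      push_cast
      linarith
    · obtain ⟨a, ha⟩ : ∃ a, G.degree u = a + 1 := ⟨G.degree u - 1, by omega⟩
      obtain ⟨b, hb⟩ : ∃ b, G.degree v = b + 1 := ⟨G.degree v - 1, by omega⟩
      have ha0 : 0 < a := by omega
      have hb0 : 0 < b := by omega
      have hcb : (G.neighborFinset u ∩ G.neighborFinset v).card ≤ b := by
        have hsub : G.neighborFinset u ∩ G.neighborFinset v ⊆ (G.neighborFinset v).erase u := by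
          intro x hx
          simp only [Finset.mem_inter, mem_neighborFinset, Finset.mem_erase] at hx ⊢
          exact ⟨hx.1.ne', hx.2⟩
        refine (Finset.card_le_card hsub).trans ?_
        rw [Finset.card_erase_of_mem (by simpa using hadj.symm), card_neighborFinset_eq_degree]
        omega
      have key := G.degree_add_degree_add_one_add_le (by omega) (a := a) (b := b) hadj
        (by rw [ha]; push_cast; rfl) (by rw [hb]; push_cast; rfl) (by exact_mod_cast ha0)
        (by exact_mod_cast hb0)
      set c := (G.neighborFinset u ∩ G.neighborFinset v).card with hc
      have hden : (0 : ℝ) < ((a : ℝ) + b) * ((a : ℝ) + b + 1) := by positivity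
      have hcab : c ≤ a * b := hcb.trans (Nat.le_mul_of_pos_left b ha0)
      have hcab' : (c : ℝ) ≤ (a : ℝ) * b := by exact_mod_cast hcab
      refine ⟨le_trans (le_add_of_nonneg_right
        (div_nonneg (by linarith) hden.le)) key, fun heq => Or.inl ?_⟩
      have hle : c = a * b := by
        refine le_antisymm hcab ?_
        by_contra! hlt
        have hlt' : (c : ℝ) < (a : ℝ) * b := by exact_mod_cast hlt
        have : 0 < 2 * ((a : ℝ) * b - c) / (((a : ℝ) + b) * ((a : ℝ) + b + 1)) :=
          div_pos (by linarith) hden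
        linarith
      have ha1 : a = 1 := by nlinarith
      have hb1 : b = 1 := by omega
      obtain ⟨w, hw⟩ := Finset.card_pos.1 (by rw [← hc, hle, ha1, hb1]; norm_num)
      rw [Finset.mem_inter, mem_neighborFinset, mem_neighborFinset] at hw
      exact hG.nonempty_iso_top_fin_three (fun x => by have := hu x; omega) hadj hw.1 hw.2
  refine ⟨main.1, main.2, ?_⟩
  rintro (⟨⟨φ⟩⟩ | ⟨c, hc⟩)
  · have hcard : Fintype.card V = 3 := by simpa using Fintype.card_congr φ.toEquiv
    have htop : ∀ x y, x ≠ y → G.Adj x y := fun x y hxy => by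
      rw [← φ.map_adj_iff]; simpa using hxy
    refine le_antisymm ((signlessLapEigenvalue_add_le_five hcard htop).trans ?_) main.1
    rw [degree_of_forall_adj htop, degree_of_forall_adj htop, hcard]
    norm_num
  · have hcard := signlessLapEigenvalue_add_le_of_eq_starGraph (by omega) hc
    refine le_antisymm (hcard.trans ?_) main.1
    have hcu := hu c
    rw [degree_eq_of_eq_starGraph hc, if_pos rfl] at hcu
    have hv0 := hdeg v
    have : Fintype.card V ≤ G.degree u + G.degree v := by omega
    have : (Fintype.card V : ℝ) ≤ G.degree u + G.degree v := by exact_mod_cast this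
    linarith
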